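/- Let $X$ be a (real or complex) Banach space, let $A : D(A) \to X$ be a linear operator with $D(A)$ a dense subspace of $X$, and let $M\in\mathbb R$. Write $\rho(A)$ for the set of scalars $\lambda$ such that $\lambda I-A : D(A)\to X$ is bijective with bounded inverse, and for $\tau>0$ with $\frac1\tau\in\rho(A)$ let $$V_\tau:=(\tau A+I)(\tau A-I)^{-1},$$ which is a bounded operator on $X$. Then the following assertions are equivalent. (i) $A$ generates a $C_0$-semigroup $(T(t))_{t\ge 0}$ on $X$ satisfying $\|T(t)\|\le M$ for every $t\ge 0$. (ii) $(0,\infty)\subset\rho(A)$, and $$\left\|\left[\frac{V_\tau-I}{2}\right]^n\right\|\le M\quad\text{for all }\tau>0\text{ and } n\in\mathbb N=\{1,2,\dots\}.$$ (iii) There exists $\tau_0>0$ such that $(\frac1{\tau_0},\infty)\subset\rho(A)$, and $$\left\|\left[\frac{V_\tau-I}{2}\right]^n\right\|\le M\quad\text{for all }0<\tau<\tau_0\text{ and } n\in\mathbb N=\{1,2,\dots\}.$$ -/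

import Mathlib

open Set Filter Topology
open scoped NNReal

section Semigroup

variable {𝕜 X : Type*} [RCLike 𝕜] [NormedAddCommGroup X] [NormedSpace 𝕜 X]

/-- `T` is a `C₀`-semigroup (strongly continuous one-parameter semigroup) of bounded linear
operators on `X`. -/
structure IsC0Semigroup (T : ℝ≥0 → X →L[𝕜] X) : Prop where
  map_zero : T 0 = 1
  map_add : ∀ s t : ℝ≥0, T (s + t) = T s * T t
  continuous_orbit : ∀ x : X, Continuous fun t : ℝ≥0 => T t x

/-- `A` is the generator of `T`: the domain of `A` consists of all `x` for which the limit of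
`(T t x - x) / t` as `t ↓ 0` exists, and `A x` is this limit. -/
def IsC0Generator (A : X →ₗ.[𝕜] X) (T : ℝ≥0 → X →L[𝕜] X) : Prop :=
  ∀ x y : X, (x, y) ∈ A.graph ↔
    Tendsto (fun t : ℝ≥0 => (((t : ℝ) : 𝕜))⁻¹ • (T t x - x)) (𝓝[>] 0) (𝓝 y)

end Semigroup

namespace LinearPMap

variable {𝕜 X : Type*} [RCLike 𝕜] [NormedAddCommGroup X] [NormedSpace 𝕜 X]

/-- The bounded operator `R` on `X` is a two-sided inverse of `z I - A : D(A) → X`. -/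
structure IsResolventAt (A : X →ₗ.[𝕜] X) (z : 𝕜) (R : X →L[𝕜] X) : Prop where
  mem_domain : ∀ x : X, R x ∈ A.domain
  right_inv : ∀ x : X, z • R x - A ⟨R x, mem_domain x⟩ = x
  left_inv : ∀ x : A.domain, R (z • (x : X) - A x) = x

/-- The resolvent set `ρ(A)` of a partially defined operator: those `z` for which
`z I - A : D(A) → X` is bijective with bounded inverse. -/
def resolventSet (A : X →ₗ.[𝕜] X) : Set 𝕜 :=
  {z | ∃ R : X →L[𝕜] X, A.IsResolventAt z R}

/-- The bounded operator `V` is `(τ A + I) (τ A - I)⁻¹`: the operator `τ A - I : D(A) → X` is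
bijective and `V` maps `(τ A - I) y` to `(τ A + I) y` for every `y ∈ D(A)`. -/
def IsCayleyTransform (A : X →ₗ.[𝕜] X) (τ : 𝕜) (V : X →L[𝕜] X) : Prop :=
  Function.Bijective (fun y : A.domain => τ • A y - (y : X)) ∧
    ∀ y : A.domain, V (τ • A y - (y : X)) = τ • A y + (y : X)

open Classical in
/-- The bounded operator `V_τ = (τ A + I) (τ A - I)⁻¹`. It exists and is unique as soon as
`τ ≠ 0` and `1 / τ ∈ ρ(A)`, see `isCayleyTransform_cayleyTransform` and
`IsCayleyTransform.unique`; the value `0` is used if it does not exist. -/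
noncomputable def cayleyTransform (A : X →ₗ.[𝕜] X) (τ : 𝕜) : X →L[𝕜] X :=
  if h : ∃ V : X →L[𝕜] X, A.IsCayleyTransform τ V then h.choose else 0

theorem IsCayleyTransform.unique {A : X →ₗ.[𝕜] X} {τ : 𝕜} {V W : X →L[𝕜] X}
    (hV : A.IsCayleyTransform τ V) (hW : A.IsCayleyTransform τ W) : V = W := by
  ext x
  obtain ⟨y, rfl⟩ := hV.1.2 x
  exact (hV.2 y).trans (hW.2 y).symm

theorem isCayleyTransform_cayleyTransform {A : X →ₗ.[𝕜] X} {τ : 𝕜} (hτ : τ ≠ 0)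
    (h : τ⁻¹ ∈ A.resolventSet) : A.IsCayleyTransform τ (A.cayleyTransform τ) := by
  have hex : ∃ V : X →L[𝕜] X, A.IsCayleyTransform τ V := by
    obtain ⟨R, hR⟩ := h
    have key : ∀ y : A.domain, R (τ • A y - (y : X)) = -(τ • (y : X)) := by
      intro y
      have h1 : τ • A y - (y : X) = -(τ • (τ⁻¹ • (y : X) - A y)) := by
        rw [smul_sub, smul_smul, mul_inv_cancel₀ hτ, one_smul, neg_sub]
      rw [h1, _root_.map_neg, _root_.map_smul, hR.left_inv y]
    refine ⟨1 - (2 * τ⁻¹) • R, ⟨fun y z hyz => ?_, fun x => ?_⟩, fun y => ?_⟩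
    · have h1 : R (τ • A y - (y : X)) = R (τ • A z - (z : X)) := congrArg R hyz
      rw [key, key, neg_inj] at h1
      exact Subtype.ext (smul_right_injective X hτ h1)
    · refine ⟨-(τ⁻¹ • ⟨R x, hR.mem_domain x⟩), ?_⟩
      have h1 := hR.right_inv x
      simp only [LinearPMap.map_neg, LinearPMap.map_smul, Submodule.coe_neg, Submodule.coe_smul,
        smul_neg, smul_smul, mul_inv_cancel₀ hτ, one_smul]
      rw [sub_neg_eq_add, neg_add_eq_sub, h1]
    · change (τ • A y - (y : X)) - (2 * τ⁻¹) • R (τ • A y - (y : X)) = _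
      rw [key, smul_neg, smul_smul, mul_assoc, inv_mul_cancel₀ hτ, mul_one, two_smul]
      abel
  rw [cayleyTransform, dif_pos hex]
  exact hex.choose_spec

end LinearPMap

/-! ### Strong limits of uniformly bounded operators -/

section StrongLimits

variable {𝕜 X : Type*} [RCLike 𝕜] [NormedAddCommGroup X] [NormedSpace 𝕜 X]

/-! With `z = 1/τ` and `R = (z - A)⁻¹`, one has `(V_τ - I)/2 = -z R`, so the power bounds are the
Hille–Yosida bounds `‖(z R)^n‖ ≤ M` (`norm_cayleyTransform_pow`), and the theorem is the bounded
Hille–Yosida theorem.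

From semigroup to resolvent: the Laplace transform of `T` at `r > 0` inverts `r - A`, and `r R`
preserves every bound `‖T t x‖ ≤ c` uniform in `t`, so its powers stay below `M`.

From resolvent to semigroup: the Yosida approximations `B k = r k (P k - 1)`, with `P k = r k R k`
and `r k → ∞`, commute, converge to `A` on the domain and satisfy `‖exp (t B k)‖ ≤ M`. Their
semigroups converge strongly (`exists_isC0Semigroup_of_commute`). The generator of the limit extends
`A`; it equals `A` because `r - A` is onto, while `r` is not an eigenvalue of the generator. -/

theorem ContinuousLinearMap.equicontinuous_of_norm_le {ι : Type*} {F : ι → X →L[𝕜] X} {M : ℝ}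
    (hF : ∀ i, ‖F i‖ ≤ M) : Equicontinuous fun i x => F i x := by
  refine (LipschitzWith.uniformEquicontinuous _ M.toNNReal fun i => ?_).equicontinuous
  refine (F i).lipschitz.weaken ?_
  rw [← NNReal.coe_le_coe]
  exact (hF i).trans (Real.le_coe_toNNReal M)

/-- Strong convergence of a bounded family of operators can be tested on a dense set. -/
theorem ContinuousLinearMap.tendsto_apply_of_dense {ι : Type*} {l : Filter ι}
    {F : ι → X →L[𝕜] X} {G : X →L[𝕜] X} {M : ℝ} (hF : ∀ i, ‖F i‖ ≤ M) {D : Set X} (hD : Dense D)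
    (h : ∀ x ∈ D, Tendsto (fun i => F i x) l (𝓝 (G x))) (x : X) :
    Tendsto (fun i => F i x) l (𝓝 (G x)) := by
  have hcl : IsClosed {x | Tendsto (fun i => F i x) l (𝓝 (G x))} :=
    (equicontinuous_of_norm_le hF).isClosed_setOfPred_tendsto G.continuous
  exact hcl.closure_subset_iff.2 h (hD x)

theorem ContinuousLinearMap.cauchySeq_apply_of_dense {F : ℕ → X →L[𝕜] X} {M : ℝ}
    (hF : ∀ i, ‖F i‖ ≤ M) {D : Set X} (hD : Dense D)
    (h : ∀ x ∈ D, CauchySeq fun i => F i x) (x : X) : CauchySeq fun i => F i x := by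
  have hM : 0 ≤ M := (norm_nonneg _).trans (hF 0)
  rw [Metric.cauchySeq_iff]
  intro ε hε
  -- `M + 1` keeps the denominator positive when `M = 0`.
  obtain ⟨y, hyD, hy⟩ := hD.exists_dist_lt x (ε := ε / (3 * (M + 1))) (by positivity)
  obtain ⟨N, hN⟩ := Metric.cauchySeq_iff.1 (h y hyD) (ε / 3) (by positivity)
  refine ⟨N, fun m hm n hn => ?_⟩
  have key : ∀ i, dist (F i x) (F i y) < ε / 3 := fun i => by
    rw [dist_eq_norm, ← map_sub]
    calc ‖F i (x - y)‖ ≤ M * ‖x - y‖ := (F i).le_of_opNorm_le (hF i) _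
      _ ≤ (M + 1) * dist x y := by rw [dist_eq_norm]; gcongr; linarith
      _ < (M + 1) * (ε / (3 * (M + 1))) := by gcongr
      _ = ε / 3 := by field_simp
  have h1 := dist_triangle4 (F m x) (F m y) (F n y) (F n x)
  have h2 := key m
  have h3 := key n
  rw [dist_comm] at h3
  have h4 := hN m hm n hn
  linarith

end StrongLimits

/-! ### Exponentials of bounded operators and their strong limits -/

section Exponential

open NormedSpace

variable {𝕜 X : Type*} [RCLike 𝕜] [NormedAddCommGroup X] [NormedSpace 𝕜 X] [CompleteSpace X]

theorem ContinuousLinearMap.exp_add_smul (B : X →L[𝕜] X) (s t : 𝕜) :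
    exp ((s + t) • B) = exp (s • B) * exp (t • B) := by
  let _ : NormedAlgebra ℚ (X →L[𝕜] X) := NormedAlgebra.restrictScalars ℚ 𝕜 _
  rw [add_smul]
  exact exp_add_of_commute (((Commute.refl B).smul_left s).smul_right t)

theorem ContinuousLinearMap.norm_exp_smul_le_of_norm_pow_le {P : X →L[𝕜] X} {M : ℝ}
    (hP : ∀ n : ℕ, ‖P ^ n‖ ≤ M) {s : ℝ} (hs : 0 ≤ s) :
    ‖exp ((s : 𝕜) • P)‖ ≤ Real.exp s * M := by
  have h1 := exp_series_hasSum_exp' (𝕂 := 𝕜) ((s : 𝕜) • P)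
  have h2 : HasSum (fun n : ℕ => (s ^ n / n.factorial) * M) (Real.exp s * M) := by
    refine HasSum.mul_right M ?_
    rw [Real.exp_eq_exp_ℝ]
    simpa [div_eq_inv_mul] using exp_series_hasSum_exp' (𝕂 := ℝ) s
  refine h1.norm_le_of_bounded h2 fun n => ?_
  rw [smul_pow, smul_smul, norm_smul]
  refine mul_le_mul (le_of_eq ?_) (hP n) (norm_nonneg _) (by positivity)
  rw [norm_mul, norm_inv, norm_pow, RCLike.norm_natCast, RCLike.norm_ofReal, abs_of_nonneg hs,
    div_eq_inv_mul]

/-- Since `exp (s (P - 1)) = e^{-s} exp (s P)`, the scalar factor cancels the growth `e^s` from the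
exponential series. -/
theorem ContinuousLinearMap.norm_exp_smul_sub_one_le {P : X →L[𝕜] X} {M : ℝ}
    (hP : ∀ n : ℕ, ‖P ^ n‖ ≤ M) {s : ℝ} (hs : 0 ≤ s) :
    ‖exp ((s : 𝕜) • (P - 1))‖ ≤ M := by
  let _ : NormedAlgebra ℚ (X →L[𝕜] X) := NormedAlgebra.restrictScalars ℚ 𝕜 _
  have h1 : (s : 𝕜) • (P - 1) = algebraMap 𝕜 _ ((-s : ℝ) : 𝕜) + (s : 𝕜) • P := by
    rw [Algebra.algebraMap_eq_smul_one, RCLike.ofReal_neg, smul_sub, neg_smul]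
    abel
  have h2 : exp (((-s : ℝ)) : 𝕜) = ((Real.exp (-s) : ℝ) : 𝕜) := by
    rw [Real.exp_eq_exp_ℝ]
    exact (algebraMap_exp_comm (𝕂 := ℝ) (𝔸 := 𝕜) (-s)).symm
  rw [h1, exp_add_of_commute (Algebra.commutes _ _), ← algebraMap_exp_comm, h2,
    ← Algebra.smul_def, norm_smul, RCLike.norm_ofReal, abs_of_pos (Real.exp_pos _)]
  calc _ ≤ Real.exp (-s) * (Real.exp s * M) := by
        gcongr
        exact norm_exp_smul_le_of_norm_pow_le hP hs
    _ = M := by rw [← mul_assoc, ← Real.exp_add]; simp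

variable [NormedSpace ℝ X] [IsScalarTower ℝ 𝕜 X]

theorem ContinuousLinearMap.hasDerivAt_exp_smul_apply (B : X →L[𝕜] X) (x : X) (t : ℝ) :
    HasDerivAt (fun t : ℝ => exp ((t : 𝕜) • B) x) (exp ((t : 𝕜) • B) (B x)) t := by
  have h1 : HasDerivAt (fun z : 𝕜 => exp (z • B) x) (exp ((t : 𝕜) • B) (B x)) (t : 𝕜) :=
    ((ContinuousLinearMap.apply 𝕜 X x).hasFDerivAt.comp_hasDerivAt _
      (hasDerivAt_exp_smul_const B (t : 𝕜)))
  have h2 : HasDerivAt (fun t : ℝ => (t : 𝕜)) 1 t := by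
    simpa using (RCLike.ofRealCLM (K := 𝕜)).hasDerivAt (x := t)
  have h3 := h1.scomp t h2
  rwa [one_smul] at h3

theorem ContinuousLinearMap.continuous_exp_smul_apply (B : X →L[𝕜] X) (x : X) :
    Continuous fun t : ℝ => exp ((t : 𝕜) • B) x :=
  continuous_iff_continuousAt.2 fun t => (B.hasDerivAt_exp_smul_apply x t).continuousAt

/-- The path `s ↦ exp (t B) exp (s (C - B)) x` joins the two vectors over `[0, t]`. By commutativity
its derivative is `exp ((t - s) B) exp (s C) (C - B) x`, where both exponents have nonnegative
times, so each factor costs `M`. -/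
theorem ContinuousLinearMap.norm_exp_smul_apply_sub_le {B C : X →L[𝕜] X} (hBC : Commute B C)
    {M : ℝ} (hB : ∀ t : ℝ, 0 ≤ t → ‖exp ((t : 𝕜) • B)‖ ≤ M)
    (hC : ∀ t : ℝ, 0 ≤ t → ‖exp ((t : 𝕜) • C)‖ ≤ M) {t : ℝ} (ht : 0 ≤ t) (x : X) :
    ‖exp ((t : 𝕜) • C) x - exp ((t : 𝕜) • B) x‖ ≤ M * M * ‖C x - B x‖ * t := by
  let _ : NormedAlgebra ℚ (X →L[𝕜] X) := NormedAlgebra.restrictScalars ℚ 𝕜 _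
  have hM : 0 ≤ M := (norm_nonneg _).trans (hB 0 le_rfl)
  have hmul : ∀ s : ℝ, exp ((t : 𝕜) • B) * exp ((s : 𝕜) • (C - B)) =
      exp (((t - s : ℝ) : 𝕜) • B) * exp ((s : 𝕜) • C) := fun s => by
    rw [← exp_add_of_commute, ← exp_add_of_commute]
    · congr 1
      push_cast
      module
    · exact (hBC.smul_left _).smul_right _
    · exact (((hBC.sub_right (Commute.refl B))).smul_left _).smul_right _
  have hderiv : ∀ s : ℝ, HasDerivAt
      (fun s : ℝ => exp ((t : 𝕜) • B) (exp ((s : 𝕜) • (C - B)) x))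
      (exp ((t : 𝕜) • B) (exp ((s : 𝕜) • (C - B)) ((C - B) x))) s := fun s =>
    (((exp ((t : 𝕜) • B)).restrictScalars ℝ).hasFDerivAt.comp_hasDerivAt s
      ((C - B).hasDerivAt_exp_smul_apply x s))
  have h := norm_image_sub_le_of_norm_deriv_le_segment' (a := 0) (b := t)
    (fun s _ => (hderiv s).hasDerivWithinAt) (C := M * M * ‖C x - B x‖) (fun s hs => ?_) t
    ⟨ht, le_rfl⟩
  · have e := hmul t
    rw [sub_self, RCLike.ofReal_zero, zero_smul, exp_zero, one_mul] at e
    rw [← e]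
    simpa using! h
  · have e : exp ((t : 𝕜) • B) (exp ((s : 𝕜) • (C - B)) ((C - B) x)) =
        exp (((t - s : ℝ) : 𝕜) • B) (exp ((s : 𝕜) • C) ((C - B) x)) :=
      DFunLike.congr_fun (hmul s) ((C - B) x)
    rw [e, mul_assoc]
    refine (ContinuousLinearMap.le_of_opNorm_le _ (hB _ (by linarith [hs.2])) _).trans ?_
    exact mul_le_mul_of_nonneg_left (ContinuousLinearMap.le_of_opNorm_le _ (hC _ hs.1) _) hM

theorem ContinuousLinearMap.exp_smul_apply_sub_eq_integral (B : X →L[𝕜] X) (x : X) (t : ℝ) :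
    exp ((t : 𝕜) • B) x - x = ∫ s in (0 : ℝ)..t, exp ((s : 𝕜) • B) (B x) := by
  rw [intervalIntegral.integral_eq_sub_of_hasDerivAt
    (fun s _ => B.hasDerivAt_exp_smul_apply x s)
    ((B.continuous_exp_smul_apply (B x)).intervalIntegrable _ _)]
  simp

/-- If commuting bounded operators generate uniformly bounded semigroups and converge strongly on a
dense set, then their semigroups converge strongly to a `C₀`-semigroup, whose orbits satisfy the
integrated differential equation on this dense set. -/
theorem exists_isC0Semigroup_of_commute {B : ℕ → X →L[𝕜] X} (hcomm : ∀ m n, Commute (B m) (B n))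
    {M : ℝ} (hM : ∀ n, ∀ t : ℝ, 0 ≤ t → ‖exp ((t : 𝕜) • B n)‖ ≤ M) {D : Set X} (hD : Dense D)
    {a : X → X} (ha : ∀ x ∈ D, Tendsto (fun n => B n x) atTop (𝓝 (a x))) :
    ∃ T : ℝ≥0 → X →L[𝕜] X, IsC0Semigroup T ∧ (∀ t, ‖T t‖ ≤ M) ∧
      ∀ x ∈ D, ∀ t : ℝ, 0 ≤ t →
        T t.toNNReal x - x = ∫ s in (0 : ℝ)..t, T s.toNNReal (a x) := by
  have hM0 : 0 ≤ M := (norm_nonneg _).trans (hM 0 0 le_rfl)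
  have hcauchy : ∀ (t : ℝ≥0) (x : X), CauchySeq fun n => exp (((t : ℝ) : 𝕜) • B n) x := by
    intro t x
    refine ContinuousLinearMap.cauchySeq_apply_of_dense (fun n => hM n t t.2) hD (fun y hy => ?_) x
    have hc := (ha y hy).cauchySeq
    rw [cauchySeq_iff_tendsto_dist_atTop_0] at hc ⊢
    have h0 : Tendsto (fun n : ℕ × ℕ => M * M * dist (B n.1 y) (B n.2 y) * t) atTop (𝓝 0) := by
      simpa using (hc.const_mul (M * M)).mul_const (t : ℝ)
    refine squeeze_zero (fun _ => dist_nonneg) (fun n => ?_) h0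
    rw [dist_eq_norm, dist_eq_norm]
    exact ContinuousLinearMap.norm_exp_smul_apply_sub_le (hcomm _ _) (hM _) (hM _) t.2 y
  choose S hS using fun t x => cauchySeq_tendsto_of_complete (hcauchy t x)
  let T : ℝ≥0 → X →L[𝕜] X := fun t =>
    continuousLinearMapOfTendsto (fun n => exp (((t : ℝ) : 𝕜) • B n)) (tendsto_pi_nhds.2 (hS t))
  have hT : ∀ (t : ℝ≥0) (x : X), Tendsto (fun n => exp (((t : ℝ) : 𝕜) • B n) x) atTop (𝓝 (T t x)) := hS
  have hTM : ∀ t, ‖T t‖ ≤ M := fun t => (T t).opNorm_le_bound hM0 fun x =>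
    le_of_tendsto (hT t x).norm (Eventually.of_forall fun n =>
      ContinuousLinearMap.le_of_opNorm_le _ (hM n t t.2) x)
  have hadd : ∀ s t, T (s + t) = T s * T t := by
    intro s t
    ext x
    refine tendsto_nhds_unique (hT (s + t) x) ?_
    have h1 : Tendsto (fun n => exp (((s : ℝ) : 𝕜) • B n) (exp (((t : ℝ) : 𝕜) • B n) x - T t x))
        atTop (𝓝 0) := by
      refine squeeze_zero_norm (a := fun n => M * ‖exp (((t : ℝ) : 𝕜) • B n) x - T t x‖)
        (fun n => ContinuousLinearMap.le_of_opNorm_le _ (hM n s s.2) _) ?_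
      simpa using (tendsto_iff_norm_sub_tendsto_zero.1 (hT t x)).const_mul M
    have h2 := h1.add (hT s (T t x))
    simp only [map_sub, sub_add_cancel, zero_add] at h2
    refine h2.congr fun n => ?_
    rw [NNReal.coe_add, RCLike.ofReal_add, ContinuousLinearMap.exp_add_smul]
    rfl
  -- Orbits starting in `D` are Lipschitz, by passing to the limit in the mean value inequality;
  -- density and the bound `M` then give strong continuity everywhere.
  have hint : ∀ x ∈ D, ∀ (s t : ℝ≥0), ‖T t x - T s x‖ ≤ M * (‖a x‖) * |(t : ℝ) - s| := by
    intro x hx s t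
    refine le_of_tendsto_of_tendsto ((hT t x).sub (hT s x)).norm
      ((((ha x hx).norm).const_mul M).mul_const _) (Eventually.of_forall fun n => ?_)
    have h := (convex_Ici (0 : ℝ)).norm_image_sub_le_of_norm_hasDerivWithin_le
      (fun u _ => ((B n).hasDerivAt_exp_smul_apply x u).hasDerivWithinAt) (C := M * ‖B n x‖)
      (fun u hu => ContinuousLinearMap.le_of_opNorm_le _ (hM n u hu) _)
      (x := (s : ℝ)) (y := (t : ℝ)) s.2 t.2
    simpa using h
  have hcont : ∀ x, Continuous fun t => T t x := by
    intro x
    refine continuous_iff_continuousAt.2 fun t => ?_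
    refine ContinuousLinearMap.tendsto_apply_of_dense hTM hD (fun y hy => ?_) x
    rw [tendsto_iff_norm_sub_tendsto_zero]
    refine squeeze_zero (fun _ => norm_nonneg _) (fun s => hint y hy t s) ?_
    have hc : Continuous fun s : ℝ≥0 => M * ‖a y‖ * |(s : ℝ) - t| := by fun_prop
    simpa using hc.tendsto t
  refine ⟨T, ⟨?_, hadd, hcont⟩, hTM, fun x hx t ht => ?_⟩
  · ext x
    refine tendsto_nhds_unique (hT 0 x) ?_
    simp
  · have h1 : Tendsto (fun n => exp ((t : 𝕜) • B n) x - x) atTop (𝓝 (T t.toNNReal x - x)) := by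
      have := (hT t.toNNReal x).sub_const x
      rwa [Real.coe_toNNReal t ht] at this
    refine tendsto_nhds_unique h1 ?_
    simp only [ContinuousLinearMap.exp_smul_apply_sub_eq_integral]
    -- A convergent sequence is bounded, which supplies the constant dominating function `M * K`.
    obtain ⟨K, hK⟩ := (ha x hx).norm.bddAbove_range
    refine intervalIntegral.tendsto_integral_filter_of_dominated_convergence (fun _ => M * K)
      (Eventually.of_forall fun n =>
        ((B n).continuous_exp_smul_apply (B n x)).aestronglyMeasurable)
      (Eventually.of_forall fun n => Eventually.of_forall fun s hs => ?_)
      intervalIntegrable_const (Eventually.of_forall fun s hs => ?_)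
    · rw [uIoc_of_le ht] at hs
      refine (ContinuousLinearMap.le_of_opNorm_le _ (hM n s hs.1.le) _).trans ?_
      gcongr
      exact hK ⟨n, rfl⟩
    · rw [uIoc_of_le ht] at hs
      have h2 : Tendsto (fun n => exp ((s : 𝕜) • B n) (B n x - a x)) atTop (𝓝 0) := by
        refine squeeze_zero_norm (a := fun n => M * ‖B n x - a x‖)
          (fun n => ContinuousLinearMap.le_of_opNorm_le _ (hM n s hs.1.le) _) ?_
        simpa using (tendsto_iff_norm_sub_tendsto_zero.1 (ha x hx)).const_mul M
      have h3 := hT s.toNNReal (a x)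
      rw [Real.coe_toNNReal s hs.1.le] at h3
      simpa using h2.add h3

end Exponential

/-! ### Orbits and generators of bounded semigroups -/

section Generator

open MeasureTheory

variable {𝕜 X : Type*} [RCLike 𝕜] [NormedAddCommGroup X] [NormedSpace 𝕜 X]
  {T : ℝ≥0 → X →L[𝕜] X}

namespace IsC0Semigroup

theorem continuous_toNNReal (hT : IsC0Semigroup T) (x : X) :
    Continuous fun t : ℝ => T t.toNNReal x :=
  (hT.continuous_orbit x).comp continuous_real_toNNReal

theorem toNNReal_add (hT : IsC0Semigroup T) {s t : ℝ} (hs : 0 ≤ s) (ht : 0 ≤ t) (x : X) :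
    T (s + t).toNNReal x = T s.toNNReal (T t.toNNReal x) := by
  rw [Real.toNNReal_add hs ht, hT.map_add]
  rfl

variable [NormedSpace ℝ X]

theorem integrableOn_exp_neg_smul (hT : IsC0Semigroup T) {M r : ℝ} (hM : ∀ t, ‖T t‖ ≤ M) (hr : 0 < r)
    (x : X) : IntegrableOn (fun u : ℝ => Real.exp (-(r * u)) • T u.toNNReal x) (Ioi 0) :=
  Integrable.mono' ((integrableOn_exp_mul_Ioi (neg_neg_of_pos hr) 0).mul_const (M * ‖x‖))
    (Continuous.aestronglyMeasurable (Continuous.smul (by fun_prop) (hT.continuous_toNNReal x)))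
    (Eventually.of_forall fun u => by
      rw [norm_smul, Real.norm_of_nonneg (Real.exp_pos _).le, neg_mul]
      gcongr
      exact ContinuousLinearMap.le_of_opNorm_le _ (hM _) _)

theorem norm_integral_exp_neg_smul_le {r : ℝ} (hr : 0 < r) {f : ℝ → X} {c : ℝ}
    (hf : ∀ u ∈ Ioi (0 : ℝ), ‖f u‖ ≤ c) :
    ‖∫ u in Ioi (0 : ℝ), Real.exp (-(r * u)) • f u‖ ≤ c / r := by
  have h := norm_integral_le_of_norm_le (μ := volume.restrict (Ioi (0 : ℝ)))
    (f := fun u => Real.exp (-(r * u)) • f u)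
    ((integrableOn_exp_mul_Ioi (neg_neg_of_pos hr) 0).mul_const c)
    ((ae_restrict_iff' measurableSet_Ioi).2 (Eventually.of_forall fun u hu => by
      rw [norm_smul, Real.norm_of_nonneg (Real.exp_pos _).le, neg_mul]
      gcongr
      exact hf u hu))
  rw [integral_mul_const, integral_exp_mul_Ioi (neg_neg_of_pos hr)] at h
  convert h using 1
  simp
  ring

variable [IsScalarTower ℝ 𝕜 X]

/-- Turns the limit defining the generator into a one-sided real derivative, so that calculus on `ℝ`
applies. -/
theorem tendsto_slope_iff (hT : IsC0Semigroup T) {x y : X} :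
    Tendsto (fun t : ℝ≥0 => (((t : ℝ) : 𝕜))⁻¹ • (T t x - x)) (𝓝[>] 0) (𝓝 y) ↔
      HasDerivWithinAt (fun t : ℝ => T t.toNNReal x) y (Ici 0) 0 := by
  have himg : ((↑) : ℝ≥0 → ℝ) '' Ioi 0 = Ioi 0 := by
    ext r
    refine ⟨?_, fun hr => ⟨⟨r, le_of_lt hr⟩, hr, rfl⟩⟩
    rintro ⟨s, hs, rfl⟩
    exact_mod_cast hs
  have hmap : 𝓝[>] (0 : ℝ) = map ((↑) : ℝ≥0 → ℝ) (𝓝[>] 0) := by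
    have h := NNReal.isEmbedding_coe.map_nhdsWithin_eq (Ioi 0) 0
    rw [himg] at h
    exact h.symm
  rw [hasDerivWithinAt_iff_tendsto_slope, Ici_sdiff_left, hmap, tendsto_map'_iff]
  refine iff_of_eq (congrArg (fun f => Tendsto f _ _) ?_)
  ext t
  simp [slope_def_module, hT.map_zero, RCLike.real_smul_eq_coe_smul (K := 𝕜)]

theorem hasDerivWithinAt_orbit (hT : IsC0Semigroup T) {x y : X}
    (h : HasDerivWithinAt (fun t : ℝ => T t.toNNReal x) y (Ici 0) 0) {t : ℝ} (ht : 0 ≤ t) :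
    HasDerivWithinAt (fun t : ℝ => T t.toNNReal x) (T t.toNNReal y) (Ici t) t := by
  have h1 : HasDerivWithinAt (fun s : ℝ => T (s - t).toNNReal x) y (Ici t) t := by
    have h2 : HasDerivWithinAt (fun s : ℝ => s - t) 1 (Ici t) t :=
      ((hasDerivAt_id t).sub_const t).hasDerivWithinAt
    have h3 : HasDerivWithinAt (fun t : ℝ => T t.toNNReal x) y (Ici 0) (t - t) := by
      rwa [sub_self]
    have h4 := h3.scomp (h := fun s => s - t) t h2 fun s hs => mem_Ici.2 (sub_nonneg.2 hs)
    rwa [one_smul] at h4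
  have h4 : HasDerivWithinAt (fun s : ℝ => T t.toNNReal (T (s - t).toNNReal x))
      (T t.toNNReal y) (Ici t) t :=
    ((T t.toNNReal).restrictScalars ℝ).hasFDerivAt.comp_hasDerivWithinAt t h1
  have h5 : ∀ s ∈ Ici t, T s.toNNReal x = T t.toNNReal (T (s - t).toNNReal x) := fun s hs => by
    rw [← hT.toNNReal_add ht (sub_nonneg.2 hs), add_sub_cancel]
  exact h4.congr h5 (h5 t self_mem_Ici)

/-- A bounded semigroup has no eigenvector for a positive eigenvalue of its generator. -/
theorem eq_zero_of_hasDerivWithinAt_smul (hT : IsC0Semigroup T) {M : ℝ} (hM : ∀ t, ‖T t‖ ≤ M)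
    {r : ℝ} (hr : 0 < r) {x : X}
    (h : HasDerivWithinAt (fun t : ℝ => T t.toNNReal x) (r • x) (Ici 0) 0) : x = 0 := by
  have hexp : ∀ t : ℝ, HasDerivAt (fun t : ℝ => Real.exp (-(r * t))) (-(r * Real.exp (-(r * t)))) t :=
    fun t => by
      have := ((hasDerivAt_id t).const_mul r).neg.exp
      simpa [mul_comm] using! this
  -- The orbit must be `e^{rt} x`, which a bounded semigroup allows only for `x = 0`. A vanishing
  -- right derivative suffices for constancy.
  have hconst : ∀ t : ℝ, 0 ≤ t → Real.exp (-(r * t)) • T t.toNNReal x = x := by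
    intro t ht
    have := constant_of_has_deriv_right_zero (a := 0) (b := t)
      (f := fun t : ℝ => Real.exp (-(r * t)) • T t.toNNReal x)
      (Continuous.continuousOn
        (Continuous.smul (by fun_prop) (hT.continuous_toNNReal x)))
      (fun s hs => by
        have := (hexp s).hasDerivWithinAt.smul (hT.hasDerivWithinAt_orbit h hs.1)
        convert! this using 1
        have hs : T s.toNNReal (r • x) = r • T s.toNNReal x :=
          ((T s.toNNReal).restrictScalars ℝ).map_smul r x
        rw [hs]
        module) t ⟨ht, le_rfl⟩
    simpa [hT.map_zero] using this
  have hbound : ∀ t : ℝ, 0 ≤ t → ‖x‖ ≤ Real.exp (-(r * t)) * (M * ‖x‖) := fun t ht => by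
    conv_lhs => rw [← hconst t ht]
    rw [norm_smul, Real.norm_of_nonneg (Real.exp_pos _).le]
    gcongr
    exact ContinuousLinearMap.le_of_opNorm_le _ (hM _) _
  have hlim : Tendsto (fun t : ℝ => Real.exp (-(r * t)) * (M * ‖x‖)) atTop (𝓝 0) := by
    have := (Real.tendsto_exp_neg_atTop_nhds_zero.comp
      (tendsto_id.const_mul_atTop hr)).mul_const (M * ‖x‖)
    simpa using! this
  exact norm_le_zero_iff.1 (ge_of_tendsto hlim ((eventually_ge_atTop 0).mono hbound))

/-! ### The Laplace transform as resolvent -/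

section Laplace

variable {M r : ℝ}

/-- The Laplace transform of a bounded semigroup. -/
theorem exists_laplace (hT : IsC0Semigroup T) (hM : ∀ t, ‖T t‖ ≤ M) (hr : 0 < r) :
    ∃ R : X →L[𝕜] X, ∀ x,
      R x = ∫ u in Ioi (0 : ℝ), Real.exp (-(r * u)) • T u.toNNReal x := by
  refine ⟨LinearMap.mkContinuous
    { toFun := fun x => ∫ u in Ioi (0 : ℝ), Real.exp (-(r * u)) • T u.toNNReal x
      map_add' := fun x y => ?_
      map_smul' := fun c x => ?_ } (M / r) fun x => ?_, fun x => rfl⟩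
  · simp only [_root_.map_add, smul_add]
    exact integral_add (hT.integrableOn_exp_neg_smul hM hr x)
      (hT.integrableOn_exp_neg_smul hM hr y)
  · simp only [map_smul, RingHom.id_apply]
    rw [← integral_smul]
    exact integral_congr_ae (Eventually.of_forall fun u => smul_comm _ c _)
  · refine (norm_integral_exp_neg_smul_le hr fun u _ =>
      ContinuousLinearMap.le_of_opNorm_le _ (hM _) x).trans (le_of_eq ?_)
    ring

variable [CompleteSpace X]

theorem apply_laplace (hT : IsC0Semigroup T) (hM : ∀ t, ‖T t‖ ≤ M) (hr : 0 < r) {h : ℝ}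
    (hh : 0 ≤ h) (x : X) :
    T h.toNNReal (∫ u in Ioi (0 : ℝ), Real.exp (-(r * u)) • T u.toNNReal x) =
      ∫ u in Ioi (0 : ℝ), Real.exp (-(r * u)) • T u.toNNReal (T h.toNNReal x) := by
  rw [← ContinuousLinearMap.integral_comp_comm _ (hT.integrableOn_exp_neg_smul hM hr x)]
  refine setIntegral_congr_fun measurableSet_Ioi fun u hu => ?_
  have hs := ((T h.toNNReal).restrictScalars ℝ).map_smul (Real.exp (-(r * u))) (T u.toNNReal x)
  refine hs.trans (congrArg _ ?_)
  change T h.toNNReal (T u.toNNReal x) = _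
  rw [← hT.toNNReal_add hh (le_of_lt hu), ← hT.toNNReal_add (le_of_lt hu) hh, add_comm]

/-- Substituting `u + h` for `u` moves the dependence on `h` into a scalar factor and an integration
bound. The right side is thus differentiable in `h` even when the orbit of `x` is not. -/
theorem apply_laplace_eq_sub (hT : IsC0Semigroup T) (hM : ∀ t, ‖T t‖ ≤ M) (hr : 0 < r) {h : ℝ}
    (hh : 0 ≤ h) (x : X) :
    T h.toNNReal (∫ u in Ioi (0 : ℝ), Real.exp (-(r * u)) • T u.toNNReal x) =
      Real.exp (r * h) • ((∫ u in Ioi (0 : ℝ), Real.exp (-(r * u)) • T u.toNNReal x) -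
        ∫ u in (0 : ℝ)..h, Real.exp (-(r * u)) • T u.toNNReal x) := by
  have hint := hT.integrableOn_exp_neg_smul hM hr x
  have h1 : (∫ u in Ioi (0 : ℝ), Real.exp (-(r * u)) • T u.toNNReal x) -
      ∫ u in (0 : ℝ)..h, Real.exp (-(r * u)) • T u.toNNReal x =
      ∫ u in Ioi h, Real.exp (-(r * u)) • T u.toNNReal x := by
    rw [sub_eq_iff_eq_add', intervalIntegral.integral_interval_add_Ioi hint
      (hint.mono_set (Ioi_subset_Ioi hh))]
  have h2 := (measurePreserving_add_right volume h).setIntegral_preimage_emb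
    (measurableEmbedding_addRight h) (fun u => Real.exp (-(r * u)) • T u.toNNReal x) (Ioi h)
  rw [preimage_add_const_Ioi, sub_self] at h2
  rw [hT.apply_laplace hM hr hh, h1, ← h2, ← integral_smul]
  refine setIntegral_congr_fun measurableSet_Ioi fun u hu => ?_
  rw [smul_smul, ← Real.exp_add, hT.toNNReal_add (le_of_lt hu) hh]
  congr 2
  ring

theorem hasDerivWithinAt_laplace (hT : IsC0Semigroup T) (hM : ∀ t, ‖T t‖ ≤ M) (hr : 0 < r)
    {R : X →L[𝕜] X}
    (hR : ∀ x, R x = ∫ u in Ioi (0 : ℝ), Real.exp (-(r * u)) • T u.toNNReal x) (x : X) :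
    HasDerivWithinAt (fun t : ℝ => T t.toNNReal (R x)) (r • R x - x) (Ici 0) 0 := by
  have hc : Continuous fun u : ℝ => Real.exp (-(r * u)) • T u.toNNReal x :=
    Continuous.smul (by fun_prop) (hT.continuous_toNNReal x)
  have h1 : HasDerivAt (fun h : ℝ => ∫ u in (0 : ℝ)..h, Real.exp (-(r * u)) • T u.toNNReal x)
      x 0 := by
    simpa [hT.map_zero] using hc.integral_hasStrictDerivAt 0 0 |>.hasDerivAt
  have h2 : HasDerivAt (fun h : ℝ => Real.exp (r * h)) r 0 := by
    simpa using ((hasDerivAt_id (0 : ℝ)).const_mul r).exp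
  have h3 := h2.smul (h1.const_sub (R x))
  have h4 : HasDerivAt (fun h : ℝ => Real.exp (r * h) • (R x -
      ∫ u in (0 : ℝ)..h, Real.exp (-(r * u)) • T u.toNNReal x)) (r • R x - x) 0 := by
    convert! h3 using 1
    simp
    abel
  have h5 : ∀ t ∈ Ici (0 : ℝ), T t.toNNReal (R x) = Real.exp (r * t) • (R x -
      ∫ u in (0 : ℝ)..t, Real.exp (-(r * u)) • T u.toNNReal x) := fun t ht => by
    rw [hR]
    exact hT.apply_laplace_eq_sub hM hr ht x
  exact h4.hasDerivWithinAt.congr h5 (h5 0 self_mem_Ici)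

/-- `T t (r R x)` is an average of the vectors `T (u + t) x` against the probability density `r
e^{-ru}`. Iterating keeps the same `c`, which gives `M` rather than `M ^ n` for the powers. -/
theorem norm_apply_smul_laplace_le (hT : IsC0Semigroup T) (hM : ∀ t, ‖T t‖ ≤ M) (hr : 0 < r)
    {R : X →L[𝕜] X}
    (hR : ∀ x, R x = ∫ u in Ioi (0 : ℝ), Real.exp (-(r * u)) • T u.toNNReal x) {x : X} {c : ℝ}
    (hx : ∀ t, ‖T t x‖ ≤ c) (t : ℝ≥0) : ‖T t (((r : 𝕜) • R) x)‖ ≤ c := by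
  have h1 : T t (((r : 𝕜) • R) x) =
      (r : 𝕜) • ∫ u in Ioi (0 : ℝ), Real.exp (-(r * u)) • T u.toNNReal (T t x) := by
    change T t ((r : 𝕜) • R x) = _
    rw [map_smul, hR]
    have := hT.apply_laplace hM hr t.2 x
    rw [NNReal.val_eq_coe, Real.toNNReal_coe] at this
    rw [this]
  rw [h1, norm_smul, RCLike.norm_ofReal, abs_of_pos hr]
  have h2 := norm_integral_exp_neg_smul_le hr (f := fun u => T u.toNNReal (T t x)) (c := c)
    fun u _ => by
      have := hx (u.toNNReal + t)
      rwa [hT.map_add] at this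
  calc _ ≤ r * (c / r) := by gcongr
    _ = c := by field_simp

theorem norm_smul_laplace_pow_le (hT : IsC0Semigroup T) (hM : ∀ t, ‖T t‖ ≤ M) (hr : 0 < r)
    {R : X →L[𝕜] X}
    (hR : ∀ x, R x = ∫ u in Ioi (0 : ℝ), Real.exp (-(r * u)) • T u.toNNReal x) (n : ℕ) :
    ‖((r : 𝕜) • R) ^ n‖ ≤ M := by
  refine ContinuousLinearMap.opNorm_le_bound _ ((norm_nonneg _).trans (hM 0)) fun x => ?_
  have h : ∀ t, ‖T t ((((r : 𝕜) • R) ^ n) x)‖ ≤ M * ‖x‖ := by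
    induction n with
    | zero => exact fun t => ContinuousLinearMap.le_of_opNorm_le _ (hM t) x
    | succ n ih =>
      rw [pow_succ']
      exact hT.norm_apply_smul_laplace_le hM hr hR ih
  simpa [hT.map_zero] using h 0

end Laplace

end IsC0Semigroup

end Generator

/-! ### Resolvent identities and the Cayley transform -/

section Resolvent

variable {𝕜 X : Type*} [RCLike 𝕜] [NormedAddCommGroup X] [NormedSpace 𝕜 X] {A : X →ₗ.[𝕜] X}

namespace LinearPMap

namespace IsResolventAt

theorem eq_add {z w : 𝕜} {R S : X →L[𝕜] X} (hR : A.IsResolventAt z R)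
    (hS : A.IsResolventAt w S) (x : X) : S x = (z - w) • R (S x) + R x := by
  have h1 := hR.left_inv ⟨S x, hS.mem_domain x⟩
  have h2 := hS.right_inv x
  have h3 : z • S x - A ⟨S x, hS.mem_domain x⟩ = (z - w) • S x + x := by
    rw [sub_eq_iff_eq_add] at h2 ⊢
    rw [sub_smul, add_assoc, ← h2, sub_add_cancel]
  rw [← _root_.map_smul, ← _root_.map_add, ← h3]
  exact h1.symm

/-- Adding the resolvent identity to its version with the roles exchanged leaves `(z - w)` times the
commutator; for `z = w` the inverse is unique. -/
theorem commute {z w : 𝕜} {R S : X →L[𝕜] X} (hR : A.IsResolventAt z R)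
    (hS : A.IsResolventAt w S) : Commute R S := by
  ext x
  change R (S x) = S (R x)
  have h1 := hR.eq_add hS x
  have h2 := hS.eq_add hR x
  by_cases hzw : z = w
  · subst hzw
    have h : ∀ y, S y = R y := fun y => by simpa using hR.eq_add hS y
    rw [h, h]
  · have h3 : (z - w) • (R (S x) - S (R x)) = 0 := by
      have : (z - w) • (R (S x) - S (R x)) =
          ((z - w) • R (S x) + R x) + ((w - z) • S (R x) + S x) - (R x + S x) := by module
      rw [this, ← h1, ← h2]
      abel
    exact sub_eq_zero.1 ((smul_eq_zero.1 h3).resolve_left (sub_ne_zero.2 hzw))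

theorem apply_eq {z : 𝕜} {R : X →L[𝕜] X} (hR : A.IsResolventAt z R) (x : A.domain) :
    z • R x = R (A x) + x := by
  have h := hR.left_inv x
  rw [_root_.map_sub, _root_.map_smul, sub_eq_iff_eq_add'] at h
  exact h

theorem norm_cayleyTransform_pow {r : ℝ} (hr : 0 < r) {R : X →L[𝕜] X}
    (hR : A.IsResolventAt ((r⁻¹ : ℝ) : 𝕜) R) (n : ℕ) :
    ‖((2 : 𝕜)⁻¹ • (A.cayleyTransform (r : 𝕜) - 1)) ^ n‖ = ‖(((r⁻¹ : ℝ) : 𝕜) • R) ^ n‖ := by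
  have hr0 : (r : 𝕜) ≠ 0 := RCLike.ofReal_ne_zero.2 hr.ne'
  have hV := isCayleyTransform_cayleyTransform hr0 ⟨R, by rwa [← RCLike.ofReal_inv]⟩
  -- On `x = r A y - y`, the left side is `y` and `R x = -r y`. The sign disappears in the norm.
  have key : (2 : 𝕜)⁻¹ • (A.cayleyTransform (r : 𝕜) - 1) = -(((r⁻¹ : ℝ) : 𝕜) • R) := by
    ext x
    obtain ⟨y, rfl⟩ := hV.1.2 x
    change (2 : 𝕜)⁻¹ • (A.cayleyTransform (r : 𝕜) ((r : 𝕜) • A y - (y : X)) -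
      ((r : 𝕜) • A y - (y : X))) = -(((r⁻¹ : ℝ) : 𝕜) • R ((r : 𝕜) • A y - (y : X)))
    rw [hV.2 y, _root_.map_sub, _root_.map_smul, smul_sub _ _ (R y), hR.apply_eq y, smul_smul, RCLike.ofReal_inv,
      inv_mul_cancel₀ hr0]
    module
  rw [key]
  rcases n.even_or_odd with hn | hn
  · rw [hn.neg_pow]
  · rw [hn.neg_pow, norm_neg]

end IsResolventAt

end LinearPMap

end Resolvent

/-! ### Both directions of the Hille–Yosida theorem -/

section Generation

variable {𝕜 X : Type*} [RCLike 𝕜] [NormedAddCommGroup X] [NormedSpace 𝕜 X]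
  [NormedSpace ℝ X] [IsScalarTower ℝ 𝕜 X] [CompleteSpace X] {A : X →ₗ.[𝕜] X} {M : ℝ}

theorem IsC0Generator.exists_isResolventAt {T : ℝ≥0 → X →L[𝕜] X} (hAT : IsC0Generator A T)
    (hT : IsC0Semigroup T) (hM : ∀ t, ‖T t‖ ≤ M) {r : ℝ} (hr : 0 < r) :
    ∃ R : X →L[𝕜] X, A.IsResolventAt (r : 𝕜) R ∧ ∀ n : ℕ, ‖((r : 𝕜) • R) ^ n‖ ≤ M := by
  obtain ⟨R, hR⟩ := hT.exists_laplace hM hr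
  have hderiv := hT.hasDerivWithinAt_laplace hM hr hR
  have hgraph : ∀ x, (R x, r • R x - x) ∈ A.graph := fun x =>
    (hAT _ _).2 (hT.tendsto_slope_iff.2 (hderiv x))
  have hmem : ∀ x, R x ∈ A.domain := fun x => LinearPMap.mem_domain_of_mem_graph (hgraph x)
  have happ : ∀ x, A ⟨R x, hmem x⟩ = r • R x - x := fun x =>
    ((LinearPMap.image_iff (hmem x)).2 (hgraph x)).symm
  refine ⟨R, ⟨hmem, fun x => ?_, fun x => ?_⟩, hT.norm_smul_laplace_pow_le hM hr hR⟩
  · rw [happ, ← RCLike.real_smul_eq_coe_smul]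
    abel
  · have hx := hT.tendsto_slope_iff.1 ((hAT _ _).1 (A.mem_graph x))
    rw [← RCLike.real_smul_eq_coe_smul]
    -- `R (r x - A x) - x` would be an eigenvector of the generator for `r`.
    refine sub_eq_zero.1 (hT.eq_zero_of_hasDerivWithinAt_smul hM hr ?_)
    convert! (hderiv (r • (x : X) - A x)).sub hx using 1
    · ext t
      simp
    · module

/-- The Hille–Yosida condition along a sequence of resolvents, with the power bounds expressed
through `z R(z, A)`, implies generation of a bounded `C₀`-semigroup. -/
theorem exists_isC0Generator_of_norm_pow_le (hA : Dense (A.domain : Set X)) {r : ℕ → ℝ}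
    (hr0 : ∀ k, 0 < r k) (hr : Tendsto r atTop atTop) {R : ℕ → X →L[𝕜] X}
    (hR : ∀ k, A.IsResolventAt (r k : 𝕜) (R k))
    (hM : ∀ k, ∀ n : ℕ, 1 ≤ n → ‖((r k : 𝕜) • R k) ^ n‖ ≤ M) :
    ∃ T : ℝ≥0 → X →L[𝕜] X, IsC0Semigroup T ∧ IsC0Generator A T ∧ ∀ t : ℝ≥0, ‖T t‖ ≤ M := by
  set P : ℕ → X →L[𝕜] X := fun k => (r k : 𝕜) • R k
  have hM1 : ∀ k, ‖P k‖ ≤ M := fun k => by simpa only [pow_one] using hM k 1 le_rfl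
  have hM0 : 0 ≤ M := (norm_nonneg _).trans (hM1 0)
  have hPA : ∀ k (x : A.domain), P k x = R k (A x) + x := fun k x => (hR k).apply_eq x
  have hRnorm : ∀ k (x : X), ‖R k x‖ ≤ (r k)⁻¹ * (M * ‖x‖) := fun k x => by
    have h1 : ‖P k x‖ ≤ M * ‖x‖ := ContinuousLinearMap.le_of_opNorm_le _ (hM1 k) x
    have h2 : ‖P k x‖ = r k * ‖R k x‖ := by
      change ‖(r k : 𝕜) • R k x‖ = _
      rw [norm_smul, RCLike.norm_ofReal, abs_of_pos (hr0 k)]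
    rw [inv_mul_eq_div, le_div_iff₀ (hr0 k)]
    linarith
  have hPlim : ∀ x, Tendsto (fun k => P k x) atTop (𝓝 x) := by
    refine ContinuousLinearMap.tendsto_apply_of_dense (G := 1) hM1 hA fun x hx => ?_
    have h0 : Tendsto (fun k => R k (A ⟨x, hx⟩)) atTop (𝓝 0) := by
      refine squeeze_zero_norm (hRnorm · _) ?_
      simpa using (tendsto_inv_atTop_zero.comp hr).mul_const (M * ‖A ⟨x, hx⟩‖)
    have h1 := h0.add_const x
    rw [zero_add] at h1
    exact h1.congr fun k => (hPA k ⟨x, hx⟩).symm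
  -- The hypothesis omits `n = 0`, which the exponential series needs; `‖1‖ ≤ M` follows from `P k →
  -- 1` strongly.
  have hPpow : ∀ k (n : ℕ), ‖P k ^ n‖ ≤ M := fun k n => by
    rcases n.eq_zero_or_pos with rfl | hn
    · rw [pow_zero]
      exact ContinuousLinearMap.opNorm_le_bound _ hM0 fun x => le_of_tendsto (hPlim x).norm
        (Eventually.of_forall fun k => ContinuousLinearMap.le_of_opNorm_le _ (hM1 k) x)
    · exact hM k n hn
  have hcomm : ∀ k l, Commute (P k) (P l) := fun k l =>
    (((hR k).commute (hR l)).smul_left _).smul_right _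
  let a : X → X := fun x => open Classical in if hx : x ∈ A.domain then A ⟨x, hx⟩ else 0
  have ha : ∀ x : A.domain, a x = A x := fun x => by simp [a]
  obtain ⟨T, hT, hTM, hTint⟩ := exists_isC0Semigroup_of_commute (𝕜 := 𝕜)
    (B := fun k => (r k : 𝕜) • (P k - 1)) (M := M) (D := A.domain) (a := a)
    (fun k l => ((((hcomm k l).sub_left (Commute.one_left _)).sub_right
      ((Commute.one_right _))).smul_left _).smul_right _)
    (fun k t ht => by
      have h := ContinuousLinearMap.norm_exp_smul_sub_one_le (hPpow k)
        (mul_nonneg ht (hr0 k).le)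
      rwa [RCLike.ofReal_mul, mul_smul] at h)
    hA
    (fun x hx => by
      rw [ha ⟨x, hx⟩]
      -- On the domain, `B k x = P k (A x)`, because `P k x - x = R k (A x)`.
      refine (hPlim (A ⟨x, hx⟩)).congr fun k => ?_
      change (r k : 𝕜) • R k (A ⟨x, hx⟩) = (r k : 𝕜) • (P k x - x)
      rw [hPA k ⟨x, hx⟩, add_sub_cancel_right])
  have hderiv : ∀ x : A.domain, HasDerivWithinAt (fun t : ℝ => T t.toNNReal x) (A x) (Ici 0) 0 := by
    intro x
    have h1 : HasDerivAt (fun t : ℝ => ∫ s in (0 : ℝ)..t, T s.toNNReal (A x)) (A x) 0 := by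
      simpa [hT.map_zero] using
        ((hT.continuous_toNNReal (A x)).integral_hasStrictDerivAt 0 0).hasDerivAt
    have h2 : ∀ t ∈ Ici (0 : ℝ),
        T t.toNNReal x = (∫ s in (0 : ℝ)..t, T s.toNNReal (A x)) + x := fun t ht => by
      rw [← ha x, ← hTint x x.2 t ht, sub_add_cancel]
    exact (h1.add_const (x : X)).hasDerivWithinAt.congr h2 (h2 0 self_mem_Ici)
  refine ⟨T, hT, fun x y => ?_, hTM⟩
  rw [hT.tendsto_slope_iff]
  constructor
  · intro h
    obtain ⟨z, rfl, rfl⟩ := (LinearPMap.mem_graph_iff A).1 h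
    exact hderiv z
  · intro h
    -- Chosen so that `r 0 z - A z = r 0 x - y`; then `x - z` satisfies the eigenvalue equation for
    -- `r 0` and vanishes.
    set z : A.domain := ⟨R 0 ((r 0 : 𝕜) • x - y), (hR 0).mem_domain _⟩
    have hAz : A z = (r 0 : 𝕜) • (z : X) - ((r 0 : 𝕜) • x - y) := by
      have h1 := (hR 0).right_inv ((r 0 : 𝕜) • x - y)
      rw [sub_eq_iff_eq_add'] at h1
      exact eq_sub_of_add_eq h1.symm
    have hxz : x = z := by
      refine sub_eq_zero.1 (hT.eq_zero_of_hasDerivWithinAt_smul hTM (hr0 0) ?_)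
      convert! h.sub (hderiv z) using 1
      · ext t
        simp
      · rw [hAz, RCLike.real_smul_eq_coe_smul (K := 𝕜)]
        module
    have hyz : A z = y := by rw [hAz, ← hxz]; abel
    rw [hxz, ← hyz]
    exact A.mem_graph z

end Generation

theorem proposition3p3 {𝕜 X : Type*} [RCLike 𝕜] [NormedAddCommGroup X] [NormedSpace 𝕜 X]
    [CompleteSpace X] (A : X →ₗ.[𝕜] X) (hA : Dense (A.domain : Set X)) (M : ℝ) :
    List.TFAE [
      ∃ T : ℝ≥0 → X →L[𝕜] X, IsC0Semigroup T ∧ IsC0Generator A T ∧ ∀ t : ℝ≥0, ‖T t‖ ≤ M,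
      (∀ t : ℝ, 0 < t → (t : 𝕜) ∈ A.resolventSet) ∧
        ∀ τ : ℝ, 0 < τ → ∀ n : ℕ, 1 ≤ n →
          ‖((2 : 𝕜)⁻¹ • (A.cayleyTransform (τ : 𝕜) - 1)) ^ n‖ ≤ M,
      ∃ τ₀ : ℝ, 0 < τ₀ ∧ (∀ t : ℝ, 1 / τ₀ < t → (t : 𝕜) ∈ A.resolventSet) ∧
        ∀ τ : ℝ, 0 < τ → τ < τ₀ → ∀ n : ℕ, 1 ≤ n →
          ‖((2 : 𝕜)⁻¹ • (A.cayleyTransform (τ : 𝕜) - 1)) ^ n‖ ≤ M] := by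
  let _ : NormedSpace ℝ X := NormedSpace.restrictScalars ℝ 𝕜 X
  have _ : IsScalarTower ℝ 𝕜 X := IsScalarTower.restrictScalars ℝ 𝕜 X
  tfae_have 1 → 2 := by
    rintro ⟨T, hT, hAT, hM⟩
    refine ⟨fun t ht => ?_, fun τ hτ n _ => ?_⟩
    · obtain ⟨R, hR, -⟩ := hAT.exists_isResolventAt hT hM ht
      exact ⟨R, hR⟩
    · obtain ⟨R, hR, hRM⟩ := hAT.exists_isResolventAt hT hM (inv_pos.2 hτ)
      rw [hR.norm_cayleyTransform_pow hτ]
      exact hRM n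
  tfae_have 2 → 3 := by
    rintro ⟨h1, h2⟩
    exact ⟨1, one_pos, fun t ht => h1 t (by linarith), fun τ hτ _ => h2 τ hτ⟩
  tfae_have 3 → 1 := by
    rintro ⟨τ₀, hτ₀, h1, h2⟩
    have hpos : 0 < 1 / τ₀ := one_div_pos.2 hτ₀
    -- The points `1/τ₀ + 1 + k` tend to infinity and their reciprocals lie in `(0, τ₀)`.
    have hlt : ∀ k : ℕ, 1 / τ₀ < 1 / τ₀ + 1 + k := fun k => by
      have : (0 : ℝ) ≤ k := k.cast_nonneg
      linarith
    choose R hR using fun k : ℕ => h1 _ (hlt k)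
    refine exists_isC0Generator_of_norm_pow_le hA (fun k => hpos.trans (hlt k))
      (tendsto_atTop_add_const_left _ _ tendsto_natCast_atTop_atTop) hR fun k n hn => ?_
    have hk := hpos.trans (hlt k)
    have h := h2 (1 / τ₀ + 1 + k)⁻¹ (inv_pos.2 hk)
      (by simpa using inv_strictAnti₀ hpos (hlt k)) n hn
    rwa [LinearPMap.IsResolventAt.norm_cayleyTransform_pow (inv_pos.2 hk)
      (by rw [inv_inv]; exact hR k), inv_inv] at h
  tfae_finish
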